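/- Let $N\ge 1$ and let $(\mathbf d,\mathbf k,\mathbf s)=((d_0,\dots,d_N),(k_1,\dots,k_N),(s_1,\dots,s_N))$ be an architecture of a linear convolutional network (LCN) of depth $N$: tuples of positive integers with $d_i=\frac{d_{i-1}-k_i}{s_i}+1$ for $1\le i\le N$. For a filter $u\in\mathbb R^{k}$ and a stride $s$, the associated convolutional matrix $W\in\mathbb R^{b\times a}$ has the entries $W_{j,(j-1)s+n}=u_n$ for $1\le j\le b$, $1\le n\le k$, and zeros elsewhere. Put $\bar k=\sum_{i=1}^N k_i$. For $\vec w=(w^{(1)},\dots,w^{(N)})\in\mathbb R^{\bar k}$ with $w^{(i)}\in\mathbb R^{k_i}$, let $W^{(i)}\in\mathbb R^{d_i\times d_{i-1}}$ be the convolutional matrix with filter $w^{(i)}$ and stride $s_i$, and let $\Pi(\vec w)=W^{(N)}\cdots W^{(1)}\in\mathbb R^{d_N\times d_0}$. The matrix $\Pi(\vec w)$ is the convolutional matrix with stride $s_v=\prod_{i=1}^N s_i$ of a unique filter $\pi(\vec w)\in\mathbb R^{k_v}$ of width $k_v=k_1+\sum_{i=2}^N (k_i-1)\prod_{l=1}^{i-1}s_l$,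 called the end-to-end filter. Let $\ell:\mathbb R^{d_N}\times\mathbb R^{d_N}\to\mathbb R$ be a loss function, let $(x_1,y_1),\dots,(x_m,y_m)\in\mathbb R^{d_0}\times\mathbb R^{d_N}$ be training data, and let $$\mathcal L(\vec w)=\sum_{j=1}^m \ell(\Pi(\vec w)x_j,y_j),\qquad \vec w\in\mathbb R^{\bar k}.$$ Suppose that $\mathcal L$ is twice continuously differentiable and satisfies the Łojasiewicz gradient inequality at every point: for every $\vec w\in\mathbb R^{\bar k}$ there are a neighbourhood $U$ of $\vec w$ and constants $c>0$, $\mu\in[0,1)$ with $|\mathcal L(\vec w)-\mathcal L(\vec u)|^{\mu}\le c\,\|\nabla\mathcal L(\vec u)\|$ for all $\vec u\in U$. Let $\vec w_0\in\mathbb R^{\bar k}$ and consider $$\frac{d\vec w(t)}{dt}=-\nabla\mathcal L(\vec w(t)),\qquad \vec w(0)=\vec w_0. \tag{$*$}$$ 1. There are an open interval $I\ni 0$ and a solution $\vec w:I\to\mathbb R^{\bar k}$ of $(*)$ that is maximal (it does not extend to a solution on a larger open interval) and unique: every solution of $(*)$ on an open interval $J\ni 0$ satisfies $J\subseteq I$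 and coincides with $\vec w$ on $J$. 2. If there is a non-decreasing function $g:\mathbb R\to\mathbb R_{\ge 0}$ with $\|\pi(\vec u)\|_1\le g(\mathcal L(\vec u))$ for all $\vec u\in\mathbb R^{\bar k}$, then $[0,\infty)\subseteq I$, the curve $\vec w$ is bounded on $[0,\infty)$, and $\vec w(t)$ converges as $t\to\infty$ to a critical point of $\mathcal L$. -/

import Mathlib

open scoped NNReal Topology

namespace LCN

/-- An architecture `(d, k, s)` of depth `N`: layer dimensions `d₀, …, d_N`, filter widths
`k₁, …, k_N` and strides `s₁, …, s_N`, all positive. The layer `i : Fin N` maps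
`ℝ ^ d i.castSucc` to `ℝ ^ d i.succ`. The field `dim_eq` is
`d_i = (d_{i-1} - k_i) / s_i + 1` with denominators cleared. -/
structure Architecture (N : ℕ) where
  d : Fin (N + 1) → ℕ
  k : Fin N → ℕ
  s : Fin N → ℕ
  d_pos : ∀ i, 1 ≤ d i
  k_pos : ∀ i, 1 ≤ k i
  s_pos : ∀ i, 1 ≤ s i
  dim_eq : ∀ i : Fin N, d i.castSucc + s i = d i.succ * s i + k i

/-- The convolutional matrix in `ℝ ^ (b × a)` with filter `w` of width `k` and stride `s`
(0-based): row `r` carries the entries of `w` in the columns `r * s, …, r * s + (k - 1)`,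
and zeros elsewhere. -/
def convMatrix (a b : ℕ) {k : ℕ} (s : ℕ) (w : Fin k → ℝ) : Matrix (Fin b) (Fin a) ℝ :=
  fun r c => ∑ n : Fin k, if (c : ℕ) = r * s + n then w n else 0

namespace Architecture

variable {N : ℕ} (A : Architecture N)

/-- The parameter space `ℝ ^ (k₁ + ⋯ + k_N)` with its Euclidean structure. The coordinate
`⟨i, n⟩` is the `n`-th entry of the `i`-th filter. -/
abbrev Params : Type := EuclideanSpace ℝ (Σ i : Fin N, Fin (A.k i))

/-- The `i`-th filter `w⁽ⁱ⁾`. -/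
def filter (w : A.Params) (i : Fin N) : Fin (A.k i) → ℝ := fun n => w ⟨i, n⟩

/-- The convolutional matrix `W⁽ⁱ⁾` of the `i`-th layer. -/
def layerMatrix (w : A.Params) (i : Fin N) :
    Matrix (Fin (A.d i.succ)) (Fin (A.d i.castSucc)) ℝ :=
  convMatrix (A.d i.castSucc) (A.d i.succ) (A.s i) (A.filter w i)

/-- The product of the matrices of the first `j` layers, later layers standing to the left. -/
def partialProduct (w : A.Params) (j : Fin (N + 1)) :
    Matrix (Fin (A.d j)) (Fin (A.d 0)) ℝ :=
  Fin.induction (motive := fun j => Matrix (Fin (A.d j)) (Fin (A.d 0)) ℝ)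
    1 (fun i P => A.layerMatrix w i * P) j

/-- The end-to-end matrix `Π(w) = W⁽ᴺ⁾ ⋯ W⁽¹⁾`. -/
def endMatrix (w : A.Params) : Matrix (Fin (A.d (Fin.last N))) (Fin (A.d 0)) ℝ :=
  A.partialProduct w (Fin.last N)

/-- The product of the strides of the layers before layer `i`. -/
def strideBefore (i : Fin N) : ℕ := ∏ j ∈ Finset.Iio i, A.s j

/-- The stride `s_v = s₁ ⋯ s_N` of the end-to-end convolution. -/
def finalStride : ℕ := ∏ i, A.s i

/-- The width `k_v = k₁ + ∑_{i ≥ 2} (k_i - 1) s₁ ⋯ s_{i-1}` of the end-to-end filter, written as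
`1 + ∑_{i ≥ 1} (k_i - 1) s₁ ⋯ s_{i-1}`. -/
def finalWidth : ℕ := 1 + ∑ i, (A.k i - 1) * A.strideBefore i

/-- The polynomial `∑ₙ w⁽ⁱ⁾ₙ X ^ (n s₁ ⋯ s_{i-1})` attached to the `i`-th filter (`n` counted from
`0`). It serves only to show that the end-to-end filter exists. -/
noncomputable def layerPoly (w : A.Params) (i : Fin N) : Polynomial ℝ :=
  ∑ n : Fin (A.k i),
    Polynomial.C (A.filter w i n) * Polynomial.X ^ ((n : ℕ) * A.strideBefore i)

theorem filter_lt_succ (i : Fin N) :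
    (Finset.univ.filter fun j : Fin N => j.castSucc < i.succ)
      = insert i (Finset.univ.filter fun j : Fin N => j.castSucc < i.castSucc) := by
  ext j
  simp only [Finset.mem_filter, Finset.mem_univ, true_and, Finset.mem_insert,
    Fin.lt_def, Fin.val_castSucc, Fin.val_succ, Fin.ext_iff]
  omega

theorem filter_lt_castSucc (i : Fin N) :
    (Finset.univ.filter fun j : Fin N => j.castSucc < i.castSucc) = Finset.Iio i := by
  ext j
  simp

theorem filter_lt_last :
    (Finset.univ.filter fun j : Fin N => j.castSucc < Fin.last N) = Finset.univ := by
  ext j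
  simp [Fin.castSucc_lt_last]

theorem partialProduct_apply (w : A.Params) (j : Fin (N + 1)) :
    ∀ (r : Fin (A.d j)) (c : Fin (A.d 0)), A.partialProduct w j r c =
      (Polynomial.X ^ ((r : ℕ) * ∏ i ∈ Finset.univ.filter (fun i : Fin N => i.castSucc < j), A.s i)
        * ∏ i ∈ Finset.univ.filter (fun i : Fin N => i.castSucc < j), A.layerPoly w i).coeff
        (c : ℕ) := by
  induction j using Fin.induction with
  | zero =>
    intro r c
    simp [partialProduct, Matrix.one_apply, Polynomial.coeff_X_pow, Fin.ext_iff, eq_comm]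
  | succ i ih =>
    intro r c
    have hP : A.partialProduct w i.succ = A.layerMatrix w i * A.partialProduct w i.castSucc := by
      simp [partialProduct]
    have hnot : i ∉ Finset.univ.filter fun j : Fin N => j.castSucc < i.castSucc := by simp
    have hlt : ∀ n : Fin (A.k i), (r : ℕ) * A.s i + n < A.d i.castSucc := by
      intro n
      have h1 := A.dim_eq i
      have h2 : ((r : ℕ) + 1) * A.s i ≤ A.d i.succ * A.s i := Nat.mul_le_mul_right _ r.2
      have h3 := n.2
      rw [Nat.add_mul] at h2
      omega
    rw [hP, Matrix.mul_apply, filter_lt_succ, Finset.prod_insert hnot, Finset.prod_insert hnot,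
      filter_lt_castSucc]
    simp only [layerMatrix, convMatrix, Finset.sum_mul, ite_mul, zero_mul]
    rw [Finset.sum_comm]
    have key : ∀ n : Fin (A.k i),
        (∑ x : Fin (A.d i.castSucc), if (x : ℕ) = r * A.s i + n then
          A.filter w i n * A.partialProduct w i.castSucc x c else 0)
        = A.filter w i n * A.partialProduct w i.castSucc ⟨r * A.s i + n, hlt n⟩ c := by
      intro n
      rw [Finset.sum_eq_single ⟨r * A.s i + n, hlt n⟩]
      · simp
      · intro b _ hb
        rw [if_neg]
        intro h
        exact hb (Fin.ext h)
      · simp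
    rw [Finset.sum_congr rfl fun n _ => key n]
    rw [layerPoly, Finset.sum_mul, Finset.mul_sum, Polynomial.finsetSum_coeff]
    refine Finset.sum_congr rfl fun n _ => ?_
    rw [ih, filter_lt_castSucc, ← Polynomial.coeff_C_mul]
    congr 1
    change _ * (Polynomial.X ^ (((r : ℕ) * A.s i + n) * _) * _) = _
    rw [strideBefore]
    ring

theorem dim_add_stride (j : Fin (N + 1)) :
    A.d 0 + ∏ i ∈ Finset.univ.filter (fun i : Fin N => i.castSucc < j), A.s i =
      A.d j * (∏ i ∈ Finset.univ.filter (fun i : Fin N => i.castSucc < j), A.s i) +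
      (1 + ∑ i ∈ Finset.univ.filter (fun i : Fin N => i.castSucc < j),
        (A.k i - 1) * A.strideBefore i) := by
  induction j using Fin.induction with
  | zero => simp
  | succ i ih =>
    have hnot : i ∉ Finset.univ.filter fun j : Fin N => j.castSucc < i.castSucc := by simp
    rw [filter_lt_succ, Finset.prod_insert hnot, Finset.sum_insert hnot]
    rw [filter_lt_castSucc] at ih ⊢
    have h1 := A.dim_eq i
    have h2 := A.k_pos i
    obtain ⟨q, hq⟩ : ∃ q, A.k i = q + 1 := ⟨A.k i - 1, by omega⟩
    rw [hq] at h1 ⊢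
    simp only [Nat.add_sub_cancel]
    rw [strideBefore]
    nlinarith [congrArg (· * ∏ j ∈ Finset.Iio i, A.s j) h1]

/-- `(d₀, d_N), k_v, s_v` satisfy the dimension equation of a single layer. -/
theorem finalDim_eq :
    A.d 0 + A.finalStride = A.d (Fin.last N) * A.finalStride + A.finalWidth := by
  have h := A.dim_add_stride (Fin.last N)
  rwa [filter_lt_last] at h

theorem natDegree_prod_layerPoly (w : A.Params) :
    (∏ i, A.layerPoly w i).natDegree < A.finalWidth := by
  refine lt_of_le_of_lt (Polynomial.natDegree_prod_le _ _) ?_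
  rw [finalWidth, Nat.lt_one_add_iff]
  refine Finset.sum_le_sum fun i _ => ?_
  refine Polynomial.natDegree_sum_le_of_forall_le _ _ fun n _ => ?_
  refine (Polynomial.natDegree_C_mul_X_pow_le _ _).trans (Nat.mul_le_mul_right _ ?_)
  have := n.2
  omega

theorem convMatrix_coeff (w : A.Params) :
    convMatrix (A.d 0) (A.d (Fin.last N)) A.finalStride
      (fun m : Fin A.finalWidth => (∏ i, A.layerPoly w i).coeff m) = A.endMatrix w := by
  ext r c
  rw [endMatrix, partialProduct_apply, filter_lt_last, ← finalStride,
    Polynomial.coeff_X_pow_mul']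
  simp only [convMatrix]
  split_ifs with h
  · by_cases hc : (c : ℕ) - r * A.finalStride < A.finalWidth
    · rw [Finset.sum_eq_single ⟨(c : ℕ) - r * A.finalStride, hc⟩]
      · rw [if_pos]
        simp only
        omega
      · intro b _ hb
        rw [if_neg]
        intro h'
        refine hb (Fin.ext ?_)
        simp only
        omega
      · simp
    · rw [Polynomial.coeff_eq_zero_of_natDegree_lt
        (lt_of_lt_of_le (A.natDegree_prod_layerPoly w) (not_lt.mp hc))]
      refine Finset.sum_eq_zero fun n _ => if_neg ?_
      have := n.2
      omega
  · refine Finset.sum_eq_zero fun n _ => if_neg ?_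
    omega

theorem convMatrix_injective :
    Function.Injective fun v : Fin A.finalWidth → ℝ =>
      convMatrix (A.d 0) (A.d (Fin.last N)) A.finalStride v := by
  have key : ∀ (v : Fin A.finalWidth → ℝ) (m : Fin A.finalWidth) (h : (m : ℕ) < A.d 0),
      convMatrix (A.d 0) (A.d (Fin.last N)) A.finalStride v
        ⟨0, A.d_pos (Fin.last N)⟩ ⟨m, h⟩ = v m := by
    intro v m h
    simp [convMatrix, ← Fin.ext_iff]
  intro v v' hv
  ext m
  have hm : (m : ℕ) < A.d 0 := by
    have h1 := A.finalDim_eq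
    have h2 := Nat.mul_le_mul_right A.finalStride (A.d_pos (Fin.last N))
    have h3 := m.2
    omega
  rw [← key v m hm, ← key v' m hm]
  exact congrFun (congrFun hv _) _

/-- The end-to-end matrix is convolutional with width `k_v` and stride `s_v`, for exactly one
filter. -/
theorem existsUnique_finalFilter (w : A.Params) :
    ∃! v : Fin A.finalWidth → ℝ,
      convMatrix (A.d 0) (A.d (Fin.last N)) A.finalStride v = A.endMatrix w :=
  ⟨_, A.convMatrix_coeff w, fun _ hv =>
    A.convMatrix_injective (hv.trans (A.convMatrix_coeff w).symm)⟩

/-- The end-to-end filter `π(w)`: the unique filter of width `k_v` and stride `s_v` whose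
convolutional matrix is the end-to-end matrix. -/
noncomputable def finalFilter (w : A.Params) : Fin A.finalWidth → ℝ :=
  (A.existsUnique_finalFilter w).choose

theorem convMatrix_finalFilter (w : A.Params) :
    convMatrix (A.d 0) (A.d (Fin.last N)) A.finalStride (A.finalFilter w) = A.endMatrix w :=
  (A.existsUnique_finalFilter w).choose_spec.1

theorem finalFilter_apply (w : A.Params) (m : Fin A.finalWidth) :
    A.finalFilter w m = (∏ i, A.layerPoly w i).coeff m :=
  congrFun (A.convMatrix_injective
    ((A.convMatrix_finalFilter w).trans (A.convMatrix_coeff w).symm)) m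

/-- The empirical risk `w ↦ ∑ⱼ ℓ(Π(w) xⱼ, yⱼ)` for the training data `(x₁, y₁), …, (x_m, y_m)`. -/
def risk (ℓ : (Fin (A.d (Fin.last N)) → ℝ) → (Fin (A.d (Fin.last N)) → ℝ) → ℝ)
    {m : ℕ} (x : Fin m → Fin (A.d 0) → ℝ) (y : Fin m → Fin (A.d (Fin.last N)) → ℝ)
    (w : A.Params) : ℝ :=
  ∑ j, ℓ ((A.endMatrix w).mulVec (x j)) (y j)

end Architecture

/-- The Łojasiewicz gradient inequality for `φ` at `x`. -/
def LojasiewiczAt {ι : Type*} [Fintype ι] (φ : EuclideanSpace ℝ ι → ℝ)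
    (x : EuclideanSpace ℝ ι) : Prop :=
  ∃ U ∈ 𝓝 x, ∃ c : ℝ, 0 < c ∧ ∃ μ : ℝ, 0 ≤ μ ∧ μ < 1 ∧
    ∀ y ∈ U, |φ x - φ y| ^ μ ≤ c * ‖gradient φ y‖

/-- `w` solves `w' = -∇L(w)`, `w(0) = w₀` on the open interval `I ∋ 0`. Only the values of `w`
on `I` matter. -/
structure IsGradientFlow {ι : Type*} [Fintype ι] (L : EuclideanSpace ℝ ι → ℝ)
    (w₀ : EuclideanSpace ℝ ι) (I : Set ℝ) (w : ℝ → EuclideanSpace ℝ ι) : Prop where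
  isOpen : IsOpen I
  interval : I.OrdConnected
  zero_mem : (0 : ℝ) ∈ I
  init : w 0 = w₀
  hasDerivAt : ∀ t ∈ I, HasDerivAt w (-gradient L (w t)) t

/-- A solution on an open interval that does not extend to a solution on a larger one. -/
def IsMaximalGradientFlow {ι : Type*} [Fintype ι] (L : EuclideanSpace ℝ ι → ℝ)
    (w₀ : EuclideanSpace ℝ ι) (I : Set ℝ) (w : ℝ → EuclideanSpace ℝ ι) : Prop :=
  IsGradientFlow L w₀ I w ∧
    ∀ (J : Set ℝ) (u : ℝ → EuclideanSpace ℝ ι),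
      IsGradientFlow L w₀ J u → I ⊆ J → Set.EqOn u w I → J = I

end LCN

/-! The field `-∇L` is C¹, so local solutions exist and any two agree where both are defined. Gluing
all of them gives the greatest solution, which is maximal and unique.

The second part rests on boundedness. Rescaling the filters by factors of product 1 changes neither
the end-to-end filter nor the risk, and this symmetry makes each difference ‖w⁽ⁱ⁾‖² − ‖w⁽ʲ⁾‖²
constant along the flow (`filterNormSq_sub_eq`). The risk does not increase, so ‖π(w(t))‖₁ ≤
g(L(w₀)) for t ≥ 0. A product of nonzero polynomials is nonzero; with compactness and homogeneity
this yields ‖π(w)‖₁² ≥ c ∏ ‖w⁽ⁱ⁾‖² for some c > 0 (`exists_mul_prod_filterNormSq_le`). One large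
filter would force all of them, hence the product, to be large; so w stays bounded.

A bounded solution cannot end in finite forward time (`Ici_subset`). It has a cluster point, near
which the Łojasiewicz inequality bounds the distance still to be covered, so the curve converges
there (`tendsto_of_mapClusterPt`). -/

namespace LCN

open Set Filter Metric

/-! ### Gradient flow: uniqueness, greatest solution, continuation -/

section ODE

/-- Two integral curves of a `C¹` vector field on an open interval that agree at one point agree
everywhere. -/
theorem eqOn_of_hasDerivAt {E : Type*} [NormedAddCommGroup E] [NormedSpace ℝ E]
    {v : E → E} (hv : ContDiff ℝ 1 v) {f g : ℝ → E} {I : Set ℝ} (hI : IsOpen I)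
    (hI' : I.OrdConnected) {t₀ : ℝ} (ht₀ : t₀ ∈ I)
    (hf : ∀ t ∈ I, HasDerivAt f (v (f t)) t) (hg : ∀ t ∈ I, HasDerivAt g (v (g t)) t)
    (heq : f t₀ = g t₀) : EqOn f g I := by
  have loc : ∀ t ∈ I, f t = g t → f =ᶠ[𝓝 t] g := by
    intro t ht h
    obtain ⟨K, s, hs, hK⟩ := (hv.contDiffAt (x := f t)).exists_lipschitzOnWith
    refine ODE_solution_unique_of_eventually (v := fun _ => v) (s := fun _ => s) (K := K)
      (Eventually.of_forall fun _ => hK) ?_ ?_ h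
    · filter_upwards [hI.mem_nhds ht, (hf t ht).continuousAt.preimage_mem_nhds hs] with r hr hr'
      exact ⟨hf r hr, hr'⟩
    · rw [h] at hs
      filter_upwards [hI.mem_nhds ht, (hg t ht).continuousAt.preimage_mem_nhds hs] with r hr hr'
      exact ⟨hg r hr, hr'⟩
  -- The coincidence set is open by local uniqueness and closed in I by continuity, so connectedness
  -- of I gives all of I.
  have hsub : I ⊆ {t | f =ᶠ[𝓝 t] g} := by
    refine hI'.isPreconnected.subset_of_closure_inter_subset isOpen_setOfPred_eventually_nhds
      ⟨t₀, ht₀, loc t₀ ht₀ heq⟩ ?_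
    rintro t ⟨ht, htI⟩
    refine loc t htI ?_
    refine tendsto_nhds_unique_of_frequently_eq (hf t htI).continuousAt (hg t htI).continuousAt ?_
    exact (mem_closure_iff_frequently.1 ht).mono fun s hs => hs.eq_of_nhds
  exact fun t ht => (hsub ht).eq_of_nhds

variable {ι : Type*} [Fintype ι] {L : EuclideanSpace ℝ ι → ℝ} {w₀ : EuclideanSpace ℝ ι}

theorem contDiff_neg_gradient (hL : ContDiff ℝ 2 L) : ContDiff ℝ 1 fun x => -gradient L x := by
  refine ContDiff.neg ?_
  exact (InnerProductSpace.toDual ℝ (EuclideanSpace ℝ ι)).symm.contDiff.comp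
    (hL.fderiv_right (m := 1) (by norm_num))

namespace IsGradientFlow

variable {I J : Set ℝ} {w u : ℝ → EuclideanSpace ℝ ι}

theorem eqOn_inter (hL : ContDiff ℝ 2 L) (hw : IsGradientFlow L w₀ I w)
    (hu : IsGradientFlow L w₀ J u) : EqOn w u (I ∩ J) :=
  eqOn_of_hasDerivAt (contDiff_neg_gradient hL) (hw.isOpen.inter hu.isOpen)
    (hw.interval.inter hu.interval) ⟨hw.zero_mem, hu.zero_mem⟩
    (fun t ht => hw.hasDerivAt t ht.1) (fun t ht => hu.hasDerivAt t ht.2)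
    (hw.init.trans hu.init.symm)

theorem exists_local (hL : ContDiff ℝ 2 L) (w₀ : EuclideanSpace ℝ ι) :
    ∃ J u, IsGradientFlow L w₀ J u := by
  obtain ⟨α, h0, ε, hε, hα⟩ :=
    (contDiff_neg_gradient hL).contDiffAt (x := w₀)
      |>.exists_forall_mem_closedBall_exists_eq_forall_mem_Ioo_hasDerivAt₀ 0
  exact ⟨Ioo (0 - ε) (0 + ε), α, isOpen_Ioo, ordConnected_Ioo, by simp [hε], h0, hα⟩

/-- There is a solution whose interval contains that of every other solution. -/
theorem exists_greatest (hL : ContDiff ℝ 2 L) (w₀ : EuclideanSpace ℝ ι) :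
    ∃ I w, IsGradientFlow L w₀ I w ∧
      ∀ J u, IsGradientFlow L w₀ J u → J ⊆ I ∧ EqOn u w J := by
  classical
  -- The greatest interval is the union of all solution intervals; the glued curve takes at time t
  -- the value of a solution chosen for t.
  set I : Set ℝ := {t | ∃ J u, IsGradientFlow L w₀ J u ∧ t ∈ J} with hI
  have hex : ∀ t, ∃ J u, IsGradientFlow L w₀ J u ∧ (t ∈ I → t ∈ J) := by
    intro t
    by_cases h : t ∈ I
    · obtain ⟨J, u, h1, h2⟩ := h
      exact ⟨J, u, h1, fun _ => h2⟩
    · obtain ⟨J, u, h1⟩ := exists_local hL w₀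
      exact ⟨J, u, h1, fun h' => absurd h' h⟩
  choose J u hu hmem using hex
  have hsub : ∀ J' u', IsGradientFlow L w₀ J' u' → J' ⊆ I :=
    fun J' u' h t ht => ⟨J', u', h, ht⟩
  have heq : ∀ J' u', IsGradientFlow L w₀ J' u' → EqOn u' (fun t => u t t) J' :=
    fun J' u' h t ht => h.eqOn_inter hL (hu t) ⟨ht, hmem t (hsub _ _ h ht)⟩
  have h0 : (0 : ℝ) ∈ I := hsub _ _ (hu 0) (hu 0).zero_mem
  have hUnion : I = ⋃ t, J t := by
    ext t
    refine ⟨fun h => mem_iUnion.2 ⟨t, hmem t h⟩, fun h => ?_⟩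
    obtain ⟨s, hs⟩ := mem_iUnion.1 h
    exact hsub _ _ (hu s) hs
  refine ⟨I, fun t => u t t, ⟨?_, ?_, h0, (hu 0).init, ?_⟩, fun J' u' h =>
    ⟨hsub _ _ h, heq _ _ h⟩⟩
  · rw [hUnion]
    exact isOpen_iUnion fun t => (hu t).isOpen
  · rw [hUnion]
    exact (isPreconnected_iUnion ⟨0, mem_iInter.2 fun t => (hu t).zero_mem⟩
      fun t => (hu t).interval.isPreconnected).ordConnected
  · intro t ht
    refine ((hu t).hasDerivAt t (hmem t ht)).congr_of_eventuallyEq ?_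
    filter_upwards [(hu t).isOpen.mem_nhds (hmem t ht)] with s hs
    exact (heq _ _ (hu t) hs).symm

/-- A solution whose interval contains that of every other solution and that stays bounded in
forward time exists for all forward time. -/
theorem Ici_subset (hL : ContDiff ℝ 2 L) (hw : IsGradientFlow L w₀ I w)
    (hmax : ∀ J u, IsGradientFlow L w₀ J u → J ⊆ I)
    {R : ℝ} (hR : ∀ t ∈ I, 0 ≤ t → ‖w t‖ ≤ R) : Ici 0 ⊆ I := by
  classical
  by_contra hcon
  obtain ⟨T, hT0, hTI⟩ := not_subset.1 hcon
  set S : Set ℝ := Ici 0 ∩ Iᶜ with hS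
  have hbS : sInf S ∈ S := (isClosed_Ici.inter hw.isOpen.isClosed_compl).csInf_mem
    ⟨T, hT0, hTI⟩ ⟨0, fun t ht => ht.1⟩
  have hlt : ∀ t, 0 ≤ t → t < sInf S → t ∈ I := by
    intro t ht htb
    by_contra h
    exact absurd (csInf_le (s := S) ⟨0, fun t ht => ht.1⟩ ⟨ht, h⟩) (not_le.2 htb)
  generalize sInf S = b at hbS hlt
  have hb0 : 0 < b := lt_of_le_of_ne hbS.1 fun h => hbS.2 (h ▸ hw.zero_mem)
  have hev : ∀ᶠ t in 𝓝[<] b, 0 < t ∧ t < b := Ioo_mem_nhdsLT hb0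
  obtain ⟨x, -, hx⟩ := (isCompact_closedBall (0 : EuclideanSpace ℝ ι) R).exists_mapClusterPt
    (f := 𝓝[<] b) (u := w) (tendsto_principal.2 (by
      filter_upwards [hev] with t ht
      simpa using hR t (hlt t ht.1.le ht.2) ht.1.le))
  -- The existence time ε is uniform for initial values near the cluster point x. Restarting at a
  -- time t in (b − ε, b) with w t near x therefore carries the solution past b, the first time
  -- missing from I.
  obtain ⟨r, hr, ε, hε, H⟩ :=
    (contDiff_neg_gradient hL).contDiffAt (x := x)
      |>.exists_forall_mem_closedBall_exists_eq_forall_mem_Ioo_hasDerivAt 0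
  have hfr := mapClusterPt_iff_frequently.1 hx _ (closedBall_mem_nhds x hr)
  obtain ⟨t, htx, ht, htε⟩ :=
    (hfr.and_eventually (hev.and (Ioo_mem_nhdsLT (show b - ε < b by linarith)))).exists
  obtain ⟨α, hα0, hα⟩ := H _ htx
  have htI := hlt t ht.1.le ht.2
  set K := Ioo (t - ε) (t + ε) with hK
  have htK : t ∈ K := ⟨by linarith, by linarith⟩
  have hα' : ∀ s ∈ K, HasDerivAt (fun s => α (s - t)) (-gradient L (α (s - t))) s := by
    intro s hs
    have := hα (s - t) ⟨by linarith [hs.1], by linarith [hs.2]⟩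
    simpa using this.comp_sub_const s t
  have hagree : EqOn w (fun s => α (s - t)) (I ∩ K) :=
    eqOn_of_hasDerivAt (contDiff_neg_gradient hL) (hw.isOpen.inter isOpen_Ioo)
      (hw.interval.inter ordConnected_Ioo) ⟨htI, htK⟩
      (fun s hs => hw.hasDerivAt s hs.1) (fun s hs => hα' s hs.2) (by simp [hα0])
  have hflow : IsGradientFlow L w₀ (I ∪ K) (fun s => if s ∈ I then w s else α (s - t)) := by
    refine ⟨hw.isOpen.union isOpen_Ioo,
      (IsPreconnected.union t htI htK hw.interval.isPreconnected
        isPreconnected_Ioo).ordConnected,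
      Or.inl hw.zero_mem, by simp [hw.zero_mem, hw.init], ?_⟩
    intro s hs
    by_cases hsI : s ∈ I
    · simp only [hsI, if_true]
      refine (hw.hasDerivAt s hsI).congr_of_eventuallyEq ?_
      filter_upwards [hw.isOpen.mem_nhds hsI] with s' hs'
      simp [hs']
    · have hsK : s ∈ K := hs.resolve_left hsI
      simp only [hsI, if_false]
      refine (hα' s hsK).congr_of_eventuallyEq ?_
      filter_upwards [isOpen_Ioo.mem_nhds hsK] with s' hs'
      split_ifs with h
      · exact hagree ⟨h, hs'⟩
      · rfl
  exact hbS.2 (hmax _ _ hflow (Or.inr ⟨by linarith [ht.2], by linarith [htε.1]⟩))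

theorem hasDerivAt_comp (hL : ContDiff ℝ 2 L) {t : ℝ}
    (hw : HasDerivAt w (-gradient L (w t)) t) :
    HasDerivAt (fun s => L (w s)) (-‖gradient L (w t)‖ ^ 2) t := by
  have h := ((hL.differentiable (by norm_num)) (w t)).hasGradientAt.hasFDerivAt.comp_hasDerivAt t hw
  rw [InnerProductSpace.toDual_apply_apply, inner_neg_right, real_inner_self_eq_norm_sq] at h
  exact h

theorem antitoneOn_comp (hL : ContDiff ℝ 2 L) (hI : I.OrdConnected)
    (hw : ∀ t ∈ I, HasDerivAt w (-gradient L (w t)) t) : AntitoneOn (fun t => L (w t)) I := by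
  refine antitoneOn_of_hasDerivWithinAt_nonpos hI.convex
    (f' := fun t => -‖gradient L (w t)‖ ^ 2) ?_ ?_ ?_
  · exact fun t ht => (hasDerivAt_comp hL (hw t ht)).continuousAt.continuousWithinAt
  · exact fun t ht => (hasDerivAt_comp hL (hw t (interior_subset ht))).hasDerivWithinAt
  · intro t _
    simp

end IsGradientFlow

end ODE
-- Convergence of bounded gradient curves
namespace IsGradientFlow

variable {ι : Type*} [Fintype ι] {L : EuclideanSpace ℝ ι → ℝ} {w : ℝ → EuclideanSpace ℝ ι}

/-- While a gradient curve stays in a region where the Łojasiewicz inequality for `x` holds, the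
distance it covers is controlled by the decrease of the desingularised value. -/
theorem norm_sub_le_of_lojasiewicz (hL : ContDiff ℝ 2 L)
    {a b : ℝ} (hw : ∀ t ∈ Icc a b, HasDerivAt w (-gradient L (w t)) t)
    {ℓ c μ : ℝ} (hc : 0 < c) (hμ : μ < 1) (hpos : ∀ t ∈ Icc a b, ℓ < L (w t))
    (hloj : ∀ t ∈ Ico a b, (L (w t) - ℓ) ^ μ ≤ c * ‖gradient L (w t)‖) (hab : a ≤ b) :
    ‖w b - w a‖ ≤ c * ((L (w a) - ℓ) ^ (1 - μ) / (1 - μ)) := by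
  have hp : 0 < 1 - μ := by linarith
  set h : ℝ → ℝ := fun t => (L (w t) - ℓ) ^ (1 - μ) / (1 - μ) with hh
  have hd : ∀ t ∈ Icc a b, HasDerivAt (fun t => c * (h a - h t))
      (c * (‖gradient L (w t)‖ ^ 2 * (L (w t) - ℓ) ^ (-μ))) t := by
    intro t ht
    have h1 := ((hasDerivAt_comp hL (hw t ht)).sub_const ℓ).rpow_const (p := 1 - μ)
      (Or.inl (sub_pos.2 (hpos t ht)).ne')
    refine (((h1.div_const (1 - μ)).const_sub (h a)).const_mul c).congr_deriv ?_
    rw [show 1 - μ - 1 = -μ by ring]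
    field_simp
  have key := image_norm_le_of_norm_deriv_right_le_deriv_boundary' (a := a) (b := b)
    (f := fun t => w t - w a) (f' := fun t => -gradient L (w t))
    (B := fun t => c * (h a - h t))
    (fun t ht => ((hw t ht).sub_const _).continuousAt.continuousWithinAt)
    (fun t ht => ((hw t (Ico_subset_Icc_self ht)).sub_const _).hasDerivWithinAt)
    (by simp) (fun t ht => (hd t ht).continuousAt.continuousWithinAt)
    (fun t ht => (hd t (Ico_subset_Icc_self ht)).hasDerivWithinAt) ?_ (right_mem_Icc.2 hab)
  · refine key.trans ?_
    have hb : 0 ≤ h b :=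
      div_nonneg (Real.rpow_nonneg (sub_pos.2 (hpos b (right_mem_Icc.2 hab))).le _) hp.le
    gcongr
    linarith
  · intro t ht
    have hψ := sub_pos.2 (hpos t (Ico_subset_Icc_self ht))
    -- The Łojasiewicz inequality times (L(w t) − ℓ)^(−μ). It bounds the speed ‖∇L‖ by the
    -- derivative of c (h a − h t).
    have h1 : 1 ≤ c * ‖gradient L (w t)‖ * (L (w t) - ℓ) ^ (-μ) := by
      have := mul_le_mul_of_nonneg_right (hloj t ht) (Real.rpow_nonneg hψ.le (-μ))
      rwa [← Real.rpow_add hψ, add_neg_cancel, Real.rpow_zero] at this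
    rw [norm_neg]
    calc ‖gradient L (w t)‖ = ‖gradient L (w t)‖ * 1 := (mul_one _).symm
      _ ≤ ‖gradient L (w t)‖ * (c * ‖gradient L (w t)‖ * (L (w t) - ℓ) ^ (-μ)) := by gcongr
      _ = _ := by ring

/-- A gradient curve that clusters at a point satisfying the Łojasiewicz inequality converges to
it. -/
theorem tendsto_of_mapClusterPt (hL : ContDiff ℝ 2 L)
    (hw : ∀ t, 0 ≤ t → HasDerivAt w (-gradient L (w t)) t) {x : EuclideanSpace ℝ ι}
    (hx : MapClusterPt x atTop w) (hlim : Tendsto (fun t => L (w t)) atTop (𝓝 (L x)))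
    (hge : ∀ t, 0 ≤ t → L x ≤ L (w t)) (hloj : LojasiewiczAt L x) :
    Tendsto w atTop (𝓝 x) := by
  have hanti : AntitoneOn (fun t => L (w t)) (Ici 0) := antitoneOn_comp hL ordConnected_Ici hw
  -- If the limit value is attained in finite time, L is constant from then on, so the gradient
  -- vanishes and the curve is at rest. Otherwise L(w t) − L x stays positive and its real powers
  -- are differentiable.
  by_cases hT : ∃ T, 0 ≤ T ∧ L (w T) = L x
  · obtain ⟨T, hT0, hT⟩ := hT
    have hconst : ∀ t, T ≤ t → L (w t) = L x := fun t ht =>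
      le_antisymm (hT ▸ hanti hT0 (hT0.trans ht) ht) (hge t (hT0.trans ht))
    have hgrad : ∀ t ∈ Ioi T, gradient L (w t) = 0 := by
      intro t ht
      have h1 := hasDerivAt_comp hL (hw t (hT0.trans ht.le))
      have h2 : HasDerivAt (fun s => L (w s)) 0 t := by
        refine (hasDerivAt_const t (L x)).congr_of_eventuallyEq ?_
        filter_upwards [Ioi_mem_nhds ht] with s hs
        exact hconst s (le_of_lt hs)
      simpa using h1.unique h2
    obtain ⟨z, hz⟩ := isOpen_Ioi.exists_is_const_of_deriv_eq_zero (s := Ioi T)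
      (𝕜 := ℝ) (f := w) isPreconnected_Ioi
      (fun t ht => (hw t (hT0.trans (le_of_lt ht))).differentiableAt.differentiableWithinAt)
      (fun t ht => by
        rw [(hw t (hT0.trans (le_of_lt ht))).deriv, hgrad t ht, neg_zero]; rfl)
    have hz' : Tendsto w atTop (𝓝 z) := tendsto_const_nhds.congr' (by
      filter_upwards [Ioi_mem_atTop T] with t ht
      exact (hz t ht).symm)
    have hne : NeBot (𝓝 x ⊓ 𝓝 z) := ClusterPt.mono hx hz'
    rwa [eq_of_nhds_neBot hne]
  push Not at hT
  have hgt : ∀ t, 0 ≤ t → L x < L (w t) := fun t ht => lt_of_le_of_ne (hge t ht) (hT t ht).symm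
  obtain ⟨U, hU, c, hc, μ, -, hμ, hUl⟩ := hloj
  obtain ⟨r, hr, hrU⟩ := Metric.mem_nhds_iff.1 hU
  rw [Metric.tendsto_atTop]
  intro ε₀ hε₀
  obtain ⟨ε, hε, hεε₀, hεr⟩ : ∃ ε, 0 < ε ∧ ε ≤ ε₀ ∧ ε ≤ r :=
    ⟨min ε₀ r, lt_min hε₀ hr, min_le_left _ _, min_le_right _ _⟩
  have hp : 0 < 1 - μ := by linarith
  have hh : Tendsto (fun t => c * ((L (w t) - L x) ^ (1 - μ) / (1 - μ))) atTop (𝓝 0) := by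
    have h1 : Tendsto (fun t => L (w t) - L x) atTop (𝓝 0) := by
      simpa using hlim.sub_const (L x)
    have h2 := ((h1.rpow_const (p := 1 - μ) (Or.inr hp.le)).div_const (1 - μ)).const_mul c
    simpa [Real.zero_rpow hp.ne'] using h2
  -- At time a the curve is within ε/2 of x and the bound on the distance still to be covered is
  -- below ε/2, so it can never leave the ε-ball.
  obtain ⟨a, hax, hah, ha0⟩ := ((mapClusterPt_iff_frequently.1 hx _
    (ball_mem_nhds x (half_pos hε))).and_eventually
    ((hh.eventually (gt_mem_nhds (half_pos hε))).and (eventually_ge_atTop 0))).exists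
  rw [mem_ball, dist_eq_norm] at hax
  refine ⟨a, fun t hat => lt_of_lt_of_le ?_ hεε₀⟩
  by_contra! hcon
  set S : Set ℝ := Icc a t ∩ (fun s => dist (w s) x) ⁻¹' (Ici ε) with hS
  have hcont : ContinuousOn (fun s => dist (w s) x) (Icc a t) := fun s hs =>
    ((hw s (ha0.trans hs.1)).continuousAt.continuousWithinAt).dist continuousWithinAt_const
  have hbdd : BddBelow S := ⟨a, fun s hs => hs.1.1⟩
  have hτ : sInf S ∈ S := (hcont.preimage_isClosed_of_isClosed isClosed_Icc isClosed_Ici).csInf_mem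
    ⟨t, ⟨hat, le_rfl⟩, hcon⟩ hbdd
  -- `sInf S` is the first exit time. The curve is inside the ball only strictly before it, which is
  -- why the length estimate asks for the Łojasiewicz inequality on `Ico`.
  have hlt : ∀ s ∈ Ico a (sInf S), dist (w s) x < ε := by
    intro s hs
    by_contra! h
    exact absurd (csInf_le hbdd ⟨⟨hs.1, hs.2.le.trans hτ.1.2⟩, h⟩) (not_le.2 hs.2)
  have key := norm_sub_le_of_lojasiewicz (a := a) (b := sInf S) hL
    (fun s hs => hw s (ha0.trans hs.1)) hc hμ (fun s hs => hgt s (ha0.trans hs.1))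
    (fun s hs => by
      have h1 := hUl (w s) (hrU (mem_ball.2 ((hlt s hs).trans_le hεr)))
      rwa [abs_sub_comm, abs_of_pos (sub_pos.2 (hgt s (ha0.trans hs.1)))] at h1) hτ.1.1
  have h1 : ε ≤ ‖w (sInf S) - x‖ := by simpa [dist_eq_norm] using hτ.2
  have h2 := norm_sub_le_norm_sub_add_norm_sub (w (sInf S)) (w a) x
  linarith

/-- The limit of a convergent gradient curve is a critical point. -/
theorem gradient_eq_zero_of_tendsto (hL : ContDiff ℝ 2 L)
    (hw : ∀ t, 0 ≤ t → HasDerivAt w (-gradient L (w t)) t) {x : EuclideanSpace ℝ ι}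
    (hx : Tendsto w atTop (𝓝 x)) : gradient L x = 0 := by
  by_contra hne
  have hlim : Tendsto (fun t => L (w t)) atTop (𝓝 (L x)) := (hL.continuous.tendsto x).comp hx
  have hcont : Continuous (gradient L) := by
    simpa only [neg_neg] using (contDiff_neg_gradient hL).continuous.fun_neg
  have hg : Tendsto (fun t => ‖gradient L (w t)‖ ^ 2) atTop (𝓝 (‖gradient L x‖ ^ 2)) :=
    ((hcont.tendsto x).comp hx).norm.pow 2
  have hpos : 0 < ‖gradient L x‖ ^ 2 := by positivity
  obtain ⟨T, hT⟩ := eventually_atTop.1 (hg.eventually (lt_mem_nhds (half_lt_self hpos)))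
  -- The decrease of L over unit time tends to 0, yet by the mean value theorem it would eventually
  -- exceed ‖∇L(x)‖²/2.
  have hd : Tendsto (fun t => L (w (t + 1)) - L (w t)) atTop (𝓝 0) := by
    simpa using (hlim.comp (tendsto_atTop_add_const_right _ 1 tendsto_id)).sub hlim
  obtain ⟨t, ht, ht'⟩ := ((hd.eventually (lt_mem_nhds
    (show -(‖gradient L x‖ ^ 2 / 2) < 0 by linarith))).and
    (eventually_ge_atTop (max T 0))).exists
  obtain ⟨s, hs, hs'⟩ := exists_hasDerivAt_eq_slope (fun t => L (w t))
    (fun t => -‖gradient L (w t)‖ ^ 2) (lt_add_one t)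
    (fun s hs => (hasDerivAt_comp hL
      (hw s ((le_max_right _ _).trans (ht'.trans hs.1)))).continuousAt.continuousWithinAt)
    (fun s hs => hasDerivAt_comp hL (hw s ((le_max_right _ _).trans (ht'.trans hs.1.le))))
  have := hT s ((le_max_left _ _).trans (ht'.trans hs.1.le))
  rw [add_sub_cancel_left, div_one] at hs'
  linarith

/-- Bounded gradient curves converge to a critical point under the Łojasiewicz inequality. -/
theorem exists_tendsto_of_bounded (hL : ContDiff ℝ 2 L) (hloj : ∀ x, LojasiewiczAt L x)
    (hw : ∀ t, 0 ≤ t → HasDerivAt w (-gradient L (w t)) t) {R : ℝ}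
    (hR : ∀ t, 0 ≤ t → ‖w t‖ ≤ R) :
    ∃ x, Tendsto w atTop (𝓝 x) ∧ gradient L x = 0 := by
  obtain ⟨x, -, hx⟩ := (isCompact_closedBall (0 : EuclideanSpace ℝ ι) R).exists_mapClusterPt
    (f := atTop) (u := w) (tendsto_principal.2 (by
      filter_upwards [eventually_ge_atTop 0] with t ht
      simpa using hR t ht))
  have hanti : AntitoneOn (fun t => L (w t)) (Ici 0) := antitoneOn_comp hL ordConnected_Ici hw
  have hfr : ∀ ε > 0, ∃ᶠ t in atTop, dist (L (w t)) (L x) < ε := fun ε hε =>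
    mapClusterPt_iff_frequently.1 hx _
      ((hL.continuous.continuousAt (x := x)).preimage_mem_nhds (ball_mem_nhds _ hε))
  have hge : ∀ t, 0 ≤ t → L x ≤ L (w t) := by
    intro t ht
    refine le_of_forall_pos_lt_add fun ε hε => ?_
    obtain ⟨s, hs, hts⟩ := ((hfr ε hε).and_eventually (eventually_ge_atTop t)).exists
    have h1 := (abs_lt.1 (Real.dist_eq _ _ ▸ hs)).1
    have h2 := hanti ht (ht.trans hts) hts
    simp only at h2
    linarith
  have hlim : Tendsto (fun t => L (w t)) atTop (𝓝 (L x)) := by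
    rw [Metric.tendsto_atTop]
    intro ε hε
    obtain ⟨s, hs, hs0⟩ := ((hfr ε hε).and_eventually (eventually_ge_atTop 0)).exists
    refine ⟨s, fun t ht => ?_⟩
    have h1 := (abs_lt.1 (Real.dist_eq _ _ ▸ hs)).2
    have h2 := hanti hs0 (hs0.trans ht) ht
    have h3 := hge t (hs0.trans ht)
    simp only at h2
    rw [Real.dist_eq, abs_of_nonneg (by linarith)]
    linarith
  have := tendsto_of_mapClusterPt hL hw hx hlim hge (hloj x)
  exact ⟨x, this, gradient_eq_zero_of_tendsto hL hw this⟩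

end IsGradientFlow
-- Rescaling symmetry and conserved quantities
namespace Architecture

variable {N : ℕ} (A : Architecture N)

/-- Multiply the `i`-th filter by `a i`. -/
noncomputable def scaleLayers (a : Fin N → ℝ) (w : A.Params) : A.Params :=
  WithLp.toLp 2 fun p => a p.1 * w p

@[simp]
theorem scaleLayers_apply (a : Fin N → ℝ) (w : A.Params) (p : Σ i : Fin N, Fin (A.k i)) :
    A.scaleLayers a w p = a p.1 * w p := rfl

theorem layerPoly_scaleLayers (a : Fin N → ℝ) (w : A.Params) (i : Fin N) :
    A.layerPoly (A.scaleLayers a w) i = Polynomial.C (a i) * A.layerPoly w i := by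
  simp [layerPoly, filter, Finset.mul_sum, mul_assoc]

/-- Used twice: with factors of product 1 it gives the invariance of the risk, and with normalising
factors it reduces the lower bound on the end-to-end filter to unit filters. -/
theorem finalFilter_scaleLayers (a : Fin N → ℝ) (w : A.Params) (n : Fin A.finalWidth) :
    A.finalFilter (A.scaleLayers a w) n = (∏ i, a i) * A.finalFilter w n := by
  simp only [finalFilter_apply, layerPoly_scaleLayers, Finset.prod_mul_distrib]
  rw [← map_prod, Polynomial.coeff_C_mul]

theorem endMatrix_scaleLayers {a : Fin N → ℝ} (ha : ∏ i, a i = 1) (w : A.Params) :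
    A.endMatrix (A.scaleLayers a w) = A.endMatrix w := by
  have : A.finalFilter (A.scaleLayers a w) = A.finalFilter w := by
    ext n
    rw [finalFilter_scaleLayers, ha, one_mul]
  rw [← convMatrix_finalFilter, this, convMatrix_finalFilter]

theorem risk_scaleLayers
    (ℓ : (Fin (A.d (Fin.last N)) → ℝ) → (Fin (A.d (Fin.last N)) → ℝ) → ℝ)
    {m : ℕ} (x : Fin m → Fin (A.d 0) → ℝ) (y : Fin m → Fin (A.d (Fin.last N)) → ℝ)
    {a : Fin N → ℝ} (ha : ∏ i, a i = 1) (w : A.Params) :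
    A.risk ℓ x y (A.scaleLayers a w) = A.risk ℓ x y w := by
  simp only [risk, A.endMatrix_scaleLayers ha]

/-- The squared Euclidean norm of the `i`-th filter. -/
def filterNormSq (w : A.Params) (i : Fin N) : ℝ := ∑ n, w ⟨i, n⟩ ^ 2

theorem filterNormSq_nonneg (w : A.Params) (i : Fin N) : 0 ≤ A.filterNormSq w i :=
  Finset.sum_nonneg fun _ _ => sq_nonneg _

theorem norm_sq_eq_sum_filterNormSq (w : A.Params) : ‖w‖ ^ 2 = ∑ i, A.filterNormSq w i := by
  rw [EuclideanSpace.real_norm_sq_eq, Fintype.sum_sigma]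
  rfl

theorem filterNormSq_scaleLayers (a : Fin N → ℝ) (w : A.Params) (i : Fin N) :
    A.filterNormSq (A.scaleLayers a w) i = a i ^ 2 * A.filterNormSq w i := by
  simp [filterNormSq, mul_pow, Finset.mul_sum]

theorem continuous_filterNormSq (i : Fin N) : Continuous fun w => A.filterNormSq w i := by
  unfold filterNormSq
  fun_prop

/-- The infinitesimal form of the invariance. The factors exp(t eᵢ) have product exp(t ∑ eᵢ) = 1, so
L is constant along the rescaled points, whose velocity at t = 0 is `scaleLayers e w`. -/
theorem inner_gradient_scaleLayers {L : A.Params → ℝ} (hL : Differentiable ℝ L)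
    (hinv : ∀ a : Fin N → ℝ, ∏ i, a i = 1 → ∀ w, L (A.scaleLayers a w) = L w)
    {e : Fin N → ℝ} (he : ∑ i, e i = 0) (w : A.Params) :
    inner ℝ (gradient L w) (A.scaleLayers e w) = 0 := by
  have hγ : HasDerivAt (fun t : ℝ => A.scaleLayers (fun i => Real.exp (t * e i)) w)
      (A.scaleLayers e w) 0 := by
    have h : HasDerivAt (fun (t : ℝ) (p : Σ i : Fin N, Fin (A.k i)) => Real.exp (t * e p.1) * w p)
        (fun p => e p.1 * w p) 0 := by
      refine hasDerivAt_pi.2 fun p => ?_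
      have := (((hasDerivAt_id (0 : ℝ)).mul_const (e p.1)).exp).mul_const (w p)
      simpa using this
    exact (PiLp.hasFDerivAt_toLp (𝕜 := ℝ) 2 _).comp_hasDerivAt (0 : ℝ) h
  have h0 : A.scaleLayers (fun i => Real.exp (0 * e i)) w = w := by
    ext p
    simp
  have hgrad : HasFDerivAt L (InnerProductSpace.toDual ℝ A.Params (gradient L w))
      (A.scaleLayers (fun i => Real.exp (0 * e i)) w) := by
    rw [h0]
    exact (hL w).hasGradientAt.hasFDerivAt
  have h1 := hgrad.comp_hasDerivAt (0 : ℝ) hγ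
  have h2 : L ∘ (fun t : ℝ => A.scaleLayers (fun i => Real.exp (t * e i)) w) = fun _ => L w := by
    funext t
    refine hinv _ ?_ w
    rw [← Real.exp_sum, ← Finset.mul_sum, he, mul_zero, Real.exp_zero]
  rw [h2, InnerProductSpace.toDual_apply_apply] at h1
  exact h1.unique (hasDerivAt_const _ _)

/-- Differences of squared filter norms are conserved along gradient curves of functions that are
invariant under rescaling of the layers. -/
theorem filterNormSq_sub_eq {L : A.Params → ℝ} (hL : Differentiable ℝ L)
    (hinv : ∀ a : Fin N → ℝ, ∏ i, a i = 1 → ∀ w, L (A.scaleLayers a w) = L w)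
    {I : Set ℝ} {w₀ : A.Params} {w : ℝ → A.Params} (hw : IsGradientFlow L w₀ I w)
    (i j : Fin N) {t : ℝ} (ht : t ∈ I) :
    A.filterNormSq (w t) i - A.filterNormSq (w t) j =
      A.filterNormSq w₀ i - A.filterNormSq w₀ j := by
  -- For this e of sum zero, the weighted sum ∑ e w² is the difference of the two squared norms. Its
  -- derivative along the flow is −2⟨∇L(w), `scaleLayers e w`⟩ = 0.
  set e : Fin N → ℝ := Pi.single i 1 - Pi.single j 1 with he
  have hesum : ∑ l, e l = 0 := by simp [he]
  have hbal : ∀ v : A.Params, ∑ p, e p.1 * v p ^ 2 = A.filterNormSq v i - A.filterNormSq v j := by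
    intro v
    rw [Fintype.sum_sigma]
    simp only [← Finset.mul_sum, filterNormSq]
    simp [he, sub_mul, Finset.sum_sub_distrib, Pi.single_apply]
  have hderiv : ∀ s ∈ I, HasDerivAt (fun s => ∑ p, e p.1 * w s p ^ 2) 0 s := by
    intro s hs
    have h1 : ∀ p, HasDerivAt (fun s => w s p) (-gradient L (w s) p) s := fun p =>
      (PiLp.hasFDerivAt_apply (𝕜 := ℝ) 2 (w s) p).comp_hasDerivAt s (hw.hasDerivAt s hs)
    have h2 := HasDerivAt.fun_sum (u := Finset.univ)
      fun p _ => ((h1 p).fun_pow 2).const_mul (e p.1)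
    refine h2.congr_deriv ?_
    have h3 := A.inner_gradient_scaleLayers hL hinv hesum (w s)
    rw [PiLp.inner_apply] at h3
    rw [← mul_zero (-2 : ℝ), ← h3, Finset.mul_sum]
    refine Finset.sum_congr rfl fun p _ => ?_
    simp
    ring
  obtain ⟨z, hz⟩ := hw.isOpen.exists_is_const_of_deriv_eq_zero (𝕜 := ℝ) hw.interval.isPreconnected
    (fun s hs => (hderiv s hs).differentiableAt.differentiableWithinAt)
    (fun s hs => (hderiv s hs).deriv)
  rw [← hbal, ← hbal, ← hw.init, hz t ht, hz 0 hw.zero_mem]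

/-! ### Controlling the filters by the end-to-end filter -/

theorem strideBefore_pos (i : Fin N) : 0 < A.strideBefore i :=
  Finset.prod_pos fun j _ => A.s_pos j

theorem coeff_layerPoly (w : A.Params) (i : Fin N) (n : Fin (A.k i)) :
    (A.layerPoly w i).coeff (n * A.strideBefore i) = w ⟨i, n⟩ := by
  rw [layerPoly, Polynomial.finsetSum_coeff, Finset.sum_eq_single n]
  · simp [filter]
  · intro b _ hb
    rw [Polynomial.coeff_C_mul_X_pow, if_neg]
    exact fun h => hb (Fin.ext (Nat.eq_of_mul_eq_mul_right (A.strideBefore_pos i) h).symm)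
  · simp

/-- Nonzero filters give nonzero layer polynomials, and ℝ[X] is a domain. The leading coefficient of
the product is an entry of the end-to-end filter because the degree is below `finalWidth`. -/
theorem sum_abs_finalFilter_pos {w : A.Params} (hw : ∀ i, A.filterNormSq w i ≠ 0) :
    0 < ∑ n, |A.finalFilter w n| := by
  have hne : ∏ i, A.layerPoly w i ≠ 0 := by
    refine Finset.prod_ne_zero_iff.2 fun i _ h => hw i (Finset.sum_eq_zero fun n _ => ?_)
    rw [← A.coeff_layerPoly w i n, h]
    simp
  refine Finset.sum_pos' (fun _ _ => abs_nonneg _)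
    ⟨⟨_, A.natDegree_prod_layerPoly w⟩, Finset.mem_univ _, ?_⟩
  rw [abs_pos, finalFilter_apply]
  exact Polynomial.leadingCoeff_ne_zero.2 hne

theorem continuous_coeff_prod_layerPoly (s : Finset (Fin N)) (n : ℕ) :
    Continuous fun w => (∏ i ∈ s, A.layerPoly w i).coeff n := by
  classical
  induction s using Finset.induction_on generalizing n with
  | empty => simpa using continuous_const
  | insert i s hi ih =>
    simp only [Finset.prod_insert hi, Polynomial.coeff_mul]
    refine continuous_finsetSum _ fun p _ => Continuous.mul ?_ (ih _)
    simp only [layerPoly, Polynomial.finsetSum_coeff, Polynomial.coeff_C_mul, filter]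
    fun_prop

theorem continuous_finalFilter (n : Fin A.finalWidth) : Continuous fun w => A.finalFilter w n := by
  simpa only [finalFilter_apply] using A.continuous_coeff_prod_layerPoly Finset.univ n

/-- The end-to-end filter is bounded below by the product of the norms of the filters. -/
theorem exists_mul_prod_filterNormSq_le :
    ∃ c : ℝ, 0 < c ∧ ∀ w : A.Params,
      c * ∏ i, A.filterNormSq w i ≤ (∑ n, |A.finalFilter w n|) ^ 2 := by
  -- On this compact set of unit filters ‖π‖₁ is continuous and positive, so it has a positive lower
  -- bound. Homogeneity extends the bound to all parameters with no zero filter; otherwise the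
  -- product vanishes.
  set S : Set A.Params := {w | ∀ i, A.filterNormSq w i = 1} with hS
  have hcomp : IsCompact S := by
    refine isCompact_of_isClosed_isBounded ?_ ?_
    · simp only [hS, Set.ofPred_forall]
      exact isClosed_iInter fun i =>
        isClosed_eq (A.continuous_filterNormSq i) continuous_const
    · refine isBounded_iff_forall_norm_le.2 ⟨√N, fun w hw => Real.le_sqrt_of_sq_le ?_⟩
      rw [norm_sq_eq_sum_filterNormSq, Finset.sum_congr rfl fun i _ => hw i]
      simp
  obtain ⟨c, hc, hcS⟩ := hcomp.exists_forall_le'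
    (f := fun w => ∑ n, |A.finalFilter w n|)
    (continuous_finsetSum _ fun n _ => (A.continuous_finalFilter n).abs).continuousOn (a := 0)
    (fun w hw => A.sum_abs_finalFilter_pos fun i => by rw [hw i]; exact one_ne_zero)
  refine ⟨c ^ 2, by positivity, fun w => ?_⟩
  by_cases h : ∃ i, A.filterNormSq w i = 0
  · obtain ⟨i, hi⟩ := h
    rw [Finset.prod_eq_zero (Finset.mem_univ i) hi, mul_zero]
    positivity
  push Not at h
  have hpos : ∀ i, 0 < A.filterNormSq w i := fun i =>
    lt_of_le_of_ne (A.filterNormSq_nonneg w i) (h i).symm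
  set a : Fin N → ℝ := fun i => (√(A.filterNormSq w i))⁻¹ with ha
  have ha2 : ∀ i, a i ^ 2 * A.filterNormSq w i = 1 := by
    intro i
    rw [ha, inv_pow, Real.sq_sqrt (hpos i).le, inv_mul_cancel₀ (h i)]
  have h1 := hcS (A.scaleLayers a w) fun i => by rw [filterNormSq_scaleLayers, ha2]
  simp only [finalFilter_scaleLayers, abs_mul, ← Finset.mul_sum] at h1
  have h2 : |∏ i, a i| ^ 2 * ∏ i, A.filterNormSq w i = 1 := by
    rw [sq_abs, ← Finset.prod_pow, ← Finset.prod_mul_distrib]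
    exact Finset.prod_eq_one fun i _ => ha2 i
  have h3 : 0 ≤ ∏ i, A.filterNormSq w i := Finset.prod_nonneg fun i _ => (hpos i).le
  calc c ^ 2 * ∏ i, A.filterNormSq w i
      ≤ (|∏ i, a i| * ∑ n, |A.finalFilter w n|) ^ 2 * ∏ i, A.filterNormSq w i := by gcongr
    _ = (|∏ i, a i| ^ 2 * ∏ i, A.filterNormSq w i) * (∑ n, |A.finalFilter w n|) ^ 2 := by ring
    _ = _ := by rw [h2, one_mul]

/-- Balanced parameters with bounded end-to-end filter are bounded. -/
theorem exists_norm_le_of_finalFilter_le (hN : 1 ≤ N) (M G : ℝ) :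
    ∃ R : ℝ, ∀ w : A.Params, (∀ i j, A.filterNormSq w i - A.filterNormSq w j ≤ M) →
      ∑ n, |A.finalFilter w n| ≤ G → ‖w‖ ≤ R := by
  obtain ⟨c, hc, hcw⟩ := A.exists_mul_prod_filterNormSq_le
  -- The summand 1 does two things: B ≥ 1 gives B ≤ B ^ N for N ≥ 1, and c B = G² + c exceeds G². If
  -- one squared norm exceeded M + B, all would be at least B, so c B ≤ G², a contradiction.
  set B : ℝ := G ^ 2 / c + 1 with hB
  refine ⟨√(N * (M + B)), fun w hM hG => Real.le_sqrt_of_sq_le ?_⟩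
  have hfilter : ∀ i, A.filterNormSq w i ≤ M + B := by
    intro i
    by_contra! hi
    have hj : ∀ j, B ≤ A.filterNormSq w j := fun j => by linarith [hM i j]
    have hB1 : 1 ≤ B := by
      have : 0 ≤ G ^ 2 / c := by positivity
      linarith
    have h1 : B ≤ ∏ j, A.filterNormSq w j := by
      calc B ≤ B ^ N := le_self_pow₀ hB1 (by omega)
        _ = ∏ _j : Fin N, B := by simp
        _ ≤ _ := Finset.prod_le_prod (fun _ _ => by linarith) fun j _ => hj j
    have h2 : c * B ≤ G ^ 2 :=
      calc c * B ≤ c * ∏ j, A.filterNormSq w j := by gcongr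
        _ ≤ (∑ n, |A.finalFilter w n|) ^ 2 := hcw w
        _ ≤ G ^ 2 := by gcongr
    have h3 : c * B = G ^ 2 + c := by
      rw [hB]
      field_simp
    linarith
  rw [norm_sq_eq_sum_filterNormSq]
  calc ∑ i, A.filterNormSq w i ≤ ∑ _i : Fin N, (M + B) := Finset.sum_le_sum fun i _ => hfilter i
    _ = _ := by rw [Finset.sum_const, Finset.card_univ, Fintype.card_fin, nsmul_eq_mul]

end Architecture
end LCN

theorem mainTheorem2 {N : ℕ} (hN : 1 ≤ N) (A : LCN.Architecture N)
    (ℓ : (Fin (A.d (Fin.last N)) → ℝ) → (Fin (A.d (Fin.last N)) → ℝ) → ℝ)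
    {m : ℕ} (x : Fin m → Fin (A.d 0) → ℝ) (y : Fin m → Fin (A.d (Fin.last N)) → ℝ)
    (hC2 : ContDiff ℝ 2 (A.risk ℓ x y))
    (hLGI : ∀ w : A.Params, LCN.LojasiewiczAt (A.risk ℓ x y) w)
    (w₀ : A.Params) :
    ∃ (I : Set ℝ) (w : ℝ → A.Params),
      LCN.IsMaximalGradientFlow (A.risk ℓ x y) w₀ I w ∧
      (∀ (J : Set ℝ) (u : ℝ → A.Params),
        LCN.IsGradientFlow (A.risk ℓ x y) w₀ J u → J ⊆ I ∧ Set.EqOn u w J) ∧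
      ((∃ g : ℝ → ℝ≥0, Monotone g ∧
          ∀ v : A.Params, ∑ n, |A.finalFilter v n| ≤ g (A.risk ℓ x y v)) →
        Set.Ici 0 ⊆ I ∧
        Bornology.IsBounded (w '' Set.Ici 0) ∧
        ∃ wlim : A.Params,
          Filter.Tendsto w Filter.atTop (𝓝 wlim) ∧ gradient (A.risk ℓ x y) wlim = 0) := by
  obtain ⟨I, w, hw, hmax⟩ := LCN.IsGradientFlow.exists_greatest hC2 w₀
  refine ⟨I, w, ⟨hw, fun J u hu hIJ _ => (hmax J u hu).1.antisymm hIJ⟩, hmax, ?_⟩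
  rintro ⟨g, hg, hgπ⟩
  -- The sum of the initial squared norms dominates each of their differences, which the flow
  -- conserves. The bound is obtained on I first, since global existence depends on it.
  obtain ⟨R, hR⟩ := A.exists_norm_le_of_finalFilter_le hN (∑ i, A.filterNormSq w₀ i)
    (g (A.risk ℓ x y w₀))
  have hbound : ∀ t ∈ I, 0 ≤ t → ‖w t‖ ≤ R := by
    intro t ht ht0
    refine hR _ (fun i j => ?_) ((hgπ (w t)).trans (NNReal.coe_le_coe.2 (hg ?_)))
    · rw [A.filterNormSq_sub_eq (hC2.differentiable (by norm_num))
        (fun a ha v => A.risk_scaleLayers ℓ x y ha v) hw i j ht]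
      have h1 := Finset.single_le_sum (fun i _ => A.filterNormSq_nonneg w₀ i) (Finset.mem_univ i)
      have h2 := A.filterNormSq_nonneg w₀ j
      linarith
    · have h := LCN.IsGradientFlow.antitoneOn_comp hC2 hw.interval hw.hasDerivAt hw.zero_mem ht ht0
      simpa only [hw.init] using h
  have hIci : Set.Ici 0 ⊆ I := hw.Ici_subset hC2 (fun J u hu => (hmax J u hu).1) hbound
  have hbound' : ∀ t, 0 ≤ t → ‖w t‖ ≤ R := fun t ht => hbound t (hIci ht) ht
  refine ⟨hIci, isBounded_iff_forall_norm_le.2 ⟨R, ?_⟩,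
    LCN.IsGradientFlow.exists_tendsto_of_bounded hC2 hLGI
      (fun t ht => hw.hasDerivAt t (hIci ht)) hbound'⟩
  rintro _ ⟨t, ht, rfl⟩
  exact hbound' t ht
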